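/- Let $d\in\mathbb N_0$. A net $(f_\varepsilon)_{\varepsilon\in(0,1]}$ of smooth functions $f_\varepsilon\in C^\infty(\mathbb R^d;\mathbb C)$ is called moderate if for every $m\in\mathbb N_0$ and every compact $K\subset\mathbb R^d$ there is $a\in\mathbb R$ with $\sup_{|\alpha|\le m}\sup_{x\in K}|\partial^\alpha f_\varepsilon(x)|=O(\varepsilon^{a})$ as $\varepsilon\to0$, and negligible if for all $m$ and $K$ this holds for every $a\in\mathbb R$. The Colombeau algebra $\mathcal G(\mathbb R^d)$ of generalized functions is the algebra of moderate nets modulo the ideal of negligible nets. Nets of numbers, with the absolute value in place of the seminorms, give in the same way the rings $\widetilde{\mathbb R}$ and $\widetilde{\mathbb C}$ of generalized real and complex numbers. An element of $\mathcal G(\mathbb R^d)$ is a constant if it is the image of an element of $\widetilde{\mathbb C}$ under $[(c_\varepsilon)_\varepsilon]\mapsto[(x\mapsto c_\varepsilon)_\varepsilon]$. A generalized function $u\in\mathcal G(\mathbb R^d)$ is called harmonic if $\Delta u=0$ in $\mathcal G(\mathbb R^d)$, where $\Delta[(f_\varepsilon)_\varepsilon]=[(\Delta f_\varepsilon)_\varepsilon]$.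 A global harmonic representative of $u$ is a representative $(G_\varepsilon)_\varepsilon$ such that every $G_\varepsilon$ is a harmonic function on $\mathbb R^d$. Say that a net $(v_\varepsilon)_\varepsilon$ of functions on $\mathbb R^d$ has property (P) if for all real $m>0$ and $a>0$ there is $\varepsilon_{a,m}\in(0,1]$ such that, for all $0<\varepsilon<\varepsilon_{a,m}$ and all $t\in\mathbb R^d$ with $|t|<\varepsilon^{-m}$, the value $v_\varepsilon(t)$ is real and $v_\varepsilon(t)+\varepsilon^a\ge 0$. A harmonic generalized function $u$ is H-bounded from below (respectively from above) by $\widetilde c\in\widetilde{\mathbb R}$ if there are a global harmonic representative $(G_\varepsilon)_\varepsilon$ of $u$ and a representative $(c_\varepsilon)_\varepsilon$ of $\widetilde c$ such that $(G_\varepsilon-c_\varepsilon)_\varepsilon$ (respectively $(c_\varepsilon-G_\varepsilon)_\varepsilon$) has property (P). It is H-bounded from below (from above) if it is so by some $\widetilde c\in\widetilde{\mathbb R}$, and H-bounded if it is H-bounded both from below and from above. **Theorem.** Every harmonic generalized function $u\in\mathcal G(\mathbb R^d)$ that is H-bounded from below is a constant. Consequently, every H-bounded harmonic generalized function $u\in\mathcal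 G(\mathbb R^d)$ is a constant. -/

import Mathlib

open Filter Topology

noncomputable section

namespace ColombeauAlg

open scoped ContDiff
open InnerProductSpace (HarmonicOnNhd)
open Laplacian (laplacian)

/-- The parameter set `(0, 1]` of all nets. -/
abbrev Eps : Type := Set.Ioc (0 : ℝ) 1

/-- The filter on `(0, 1]` of neighbourhoods of `0`, that is, `ε → 0`. -/
def epsZero : Filter Eps := comap (fun ε : Eps => (ε : ℝ)) (𝓝 0)

/-- The space `ℝ^d` with its Euclidean norm. -/
abbrev Rd (d : ℕ) : Type := EuclideanSpace ℝ (Fin d)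

theorem rpow_le_of_le (ε : Eps) {a b : ℝ} (h : a ≤ b) : (ε : ℝ) ^ b ≤ (ε : ℝ) ^ a :=
  Real.rpow_le_rpow_of_exponent_ge ε.2.1 ε.2.2 h

theorem rpow_pos (ε : Eps) (a : ℝ) : 0 < (ε : ℝ) ^ a := Real.rpow_pos_of_pos ε.2.1 a

/-! ### Generalized numbers -/

section Numbers

variable {𝕜 : Type*} [NormedField 𝕜]

/-- `|c_ε| = O(ε^a)` as `ε → 0`. -/
def NumGrowth (c : Eps → 𝕜) (a : ℝ) : Prop :=
  ∃ C : ℝ, ∀ᶠ ε in epsZero, ‖c ε‖ ≤ C * (ε : ℝ) ^ a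

theorem NumGrowth.exists_pos {c : Eps → 𝕜} {a : ℝ} (h : NumGrowth c a) :
    ∃ C : ℝ, 0 ≤ C ∧ ∀ᶠ ε in epsZero, ‖c ε‖ ≤ C * (ε : ℝ) ^ a := by
  obtain ⟨C, hC⟩ := h
  refine ⟨max C 0, le_max_right _ _, hC.mono fun ε h => h.trans ?_⟩
  exact mul_le_mul_of_nonneg_right (le_max_left _ _) (rpow_pos ε a).le

theorem NumGrowth.mono {c : Eps → 𝕜} {a b : ℝ} (h : NumGrowth c a) (hab : b ≤ a) :
    NumGrowth c b := by
  obtain ⟨C, hC0, hC⟩ := h.exists_pos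
  exact ⟨C, hC.mono fun ε h => h.trans (mul_le_mul_of_nonneg_left (rpow_le_of_le ε hab) hC0)⟩

theorem NumGrowth.add {c e : Eps → 𝕜} {a : ℝ} (h : NumGrowth c a) (h' : NumGrowth e a) :
    NumGrowth (c + e) a := by
  obtain ⟨C, hC⟩ := h
  obtain ⟨D, hD⟩ := h'
  refine ⟨C + D, ?_⟩
  filter_upwards [hC, hD] with ε h1 h2
  calc ‖c ε + e ε‖ ≤ ‖c ε‖ + ‖e ε‖ := norm_add_le _ _
    _ ≤ (C + D) * (ε : ℝ) ^ a := by linarith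

theorem NumGrowth.mul {c e : Eps → 𝕜} {a b : ℝ} (h : NumGrowth c a) (h' : NumGrowth e b) :
    NumGrowth (c * e) (a + b) := by
  obtain ⟨C, hC0, hC⟩ := h.exists_pos
  obtain ⟨D, hD0, hD⟩ := h'.exists_pos
  refine ⟨C * D, ?_⟩
  filter_upwards [hC, hD] with ε h1 h2
  rw [Pi.mul_apply, norm_mul, Real.rpow_add ε.2.1]
  calc ‖c ε‖ * ‖e ε‖ ≤ (C * (ε : ℝ) ^ a) * (D * (ε : ℝ) ^ b) :=
        mul_le_mul h1 h2 (norm_nonneg _) (mul_nonneg hC0 (rpow_pos ε a).le)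
    _ = C * D * ((ε : ℝ) ^ a * (ε : ℝ) ^ b) := by ring

theorem numGrowth_const (z : 𝕜) : NumGrowth (fun _ => z) 0 :=
  ⟨‖z‖, Eventually.of_forall fun ε => by simp⟩

variable (𝕜)

/-- `ℰ₀`: the ring of moderate nets of numbers. -/
def ModerateNum : Subalgebra 𝕜 (Eps → 𝕜) where
  carrier := {c | ∃ a : ℝ, NumGrowth c a}
  mul_mem' := by
    rintro c e ⟨a, ha⟩ ⟨b, hb⟩
    exact ⟨a + b, ha.mul hb⟩
  add_mem' := by
    rintro c e ⟨a, ha⟩ ⟨b, hb⟩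
    exact ⟨min a b, (ha.mono (min_le_left _ _)).add (hb.mono (min_le_right _ _))⟩
  algebraMap_mem' z := ⟨0, numGrowth_const z⟩

/-- `𝒩₀`: the ideal of negligible nets of numbers. -/
def NegligibleNum : Ideal (ModerateNum 𝕜) where
  carrier := {c | ∀ b : ℝ, NumGrowth (c : Eps → 𝕜) b}
  add_mem' := fun hc he b => (hc b).add (he b)
  zero_mem' := fun b => ⟨0, Eventually.of_forall fun ε => by simp⟩
  smul_mem' := by
    rintro ⟨c, a, ha⟩ e he b
    have := ha.mul (he (b - a))
    rwa [add_sub_cancel] at this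

/-- Generalized numbers over `𝕜`: for `𝕜 = ℝ` the ring of generalized real numbers, for `𝕜 = ℂ`
the ring of generalized complex numbers. -/
abbrev GenNum : Type _ := ModerateNum 𝕜 ⧸ NegligibleNum 𝕜

end Numbers

/-! ### The Colombeau algebra of generalized functions on `ℝ^d` -/

section Functions

variable {d : ℕ}

/-- `sup_{|α| ≤ m} sup_{x ∈ K} |∂^α f_ε(x)| = O(ε^a)` as `ε → 0`; the partial derivatives of order
`k` are controlled together by the norm of the `k`-th Fréchet derivative. -/
def Growth (f : Eps → Rd d → ℂ) (m : ℕ) (K : Set (Rd d)) (a : ℝ) : Prop :=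
  ∃ C : ℝ, ∀ᶠ ε in epsZero, ∀ k ≤ m, ∀ x ∈ K, ‖iteratedFDeriv ℝ k (f ε) x‖ ≤ C * (ε : ℝ) ^ a

theorem Growth.exists_pos {f : Eps → Rd d → ℂ} {m : ℕ} {K : Set (Rd d)} {a : ℝ}
    (h : Growth f m K a) : ∃ C : ℝ, 0 ≤ C ∧ ∀ᶠ ε in epsZero, ∀ k ≤ m, ∀ x ∈ K,
      ‖iteratedFDeriv ℝ k (f ε) x‖ ≤ C * (ε : ℝ) ^ a := by
  obtain ⟨C, hC⟩ := h
  refine ⟨max C 0, le_max_right _ _, hC.mono fun ε h k hk x hx => (h k hk x hx).trans ?_⟩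
  exact mul_le_mul_of_nonneg_right (le_max_left _ _) (rpow_pos ε a).le

theorem Growth.mono {f : Eps → Rd d → ℂ} {m : ℕ} {K : Set (Rd d)} {a b : ℝ}
    (h : Growth f m K a) (hab : b ≤ a) : Growth f m K b := by
  obtain ⟨C, hC0, hC⟩ := h.exists_pos
  exact ⟨C, hC.mono fun ε h k hk x hx =>
    (h k hk x hx).trans (mul_le_mul_of_nonneg_left (rpow_le_of_le ε hab) hC0)⟩

theorem Growth.add {f g : Eps → Rd d → ℂ} {m : ℕ} {K : Set (Rd d)} {a : ℝ}
    (hfs : ∀ ε, ContDiff ℝ ∞ (f ε)) (hgs : ∀ ε, ContDiff ℝ ∞ (g ε))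
    (hf : Growth f m K a) (hg : Growth g m K a) : Growth (f + g) m K a := by
  obtain ⟨C, hC⟩ := hf
  obtain ⟨D, hD⟩ := hg
  refine ⟨C + D, ?_⟩
  filter_upwards [hC, hD] with ε h1 h2 k hk x hx
  have hkk : ((k : ℕ∞) : WithTop ℕ∞) ≤ ∞ := by exact_mod_cast le_top
  rw [Pi.add_apply, iteratedFDeriv_add_apply ((hfs ε).of_le hkk).contDiffAt
    ((hgs ε).of_le hkk).contDiffAt]
  have := norm_add_le (iteratedFDeriv ℝ k (f ε) x) (iteratedFDeriv ℝ k (g ε) x)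
  have := h1 k hk x hx
  have := h2 k hk x hx
  linarith

theorem Growth.mul {f g : Eps → Rd d → ℂ} {m : ℕ} {K : Set (Rd d)} {a b : ℝ}
    (hfs : ∀ ε, ContDiff ℝ ∞ (f ε)) (hgs : ∀ ε, ContDiff ℝ ∞ (g ε))
    (hf : Growth f m K a) (hg : Growth g m K b) : Growth (f * g) m K (a + b) := by
  obtain ⟨C, hC0, hC⟩ := hf.exists_pos
  obtain ⟨D, hD0, hD⟩ := hg.exists_pos
  refine ⟨2 ^ m * (C * D), ?_⟩
  filter_upwards [hC, hD] with ε h1 h2 k hk x hx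
  have hkk : ((k : ℕ∞) : WithTop ℕ∞) ≤ ∞ := by exact_mod_cast le_top
  have hA : 0 ≤ C * (ε : ℝ) ^ a := mul_nonneg hC0 (rpow_pos ε a).le
  have hB : 0 ≤ D * (ε : ℝ) ^ b := mul_nonneg hD0 (rpow_pos ε b).le
  calc ‖iteratedFDeriv ℝ k ((f * g) ε) x‖
      ≤ ∑ i ∈ Finset.range (k + 1), (k.choose i : ℝ) * ‖iteratedFDeriv ℝ i (f ε) x‖
          * ‖iteratedFDeriv ℝ (k - i) (g ε) x‖ :=
        norm_iteratedFDeriv_mul_le (hfs ε) (hgs ε) x hkk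
    _ ≤ ∑ i ∈ Finset.range (k + 1), (k.choose i : ℝ) * (C * (ε : ℝ) ^ a) * (D * (ε : ℝ) ^ b) := by
        refine Finset.sum_le_sum fun i hi => ?_
        have hi' : i ≤ k := Nat.lt_succ_iff.mp (Finset.mem_range.mp hi)
        have e1 := h1 i (hi'.trans hk) x hx
        have e2 := h2 (k - i) ((Nat.sub_le _ _).trans hk) x hx
        gcongr
    _ = 2 ^ k * ((C * (ε : ℝ) ^ a) * (D * (ε : ℝ) ^ b)) := by
        simp_rw [mul_assoc]
        rw [← Finset.sum_mul]
        congr 1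
        exact_mod_cast Nat.sum_range_choose k
    _ ≤ 2 ^ m * ((C * (ε : ℝ) ^ a) * (D * (ε : ℝ) ^ b)) := by
        gcongr
        norm_num
    _ = 2 ^ m * (C * D) * (ε : ℝ) ^ (a + b) := by
        rw [Real.rpow_add ε.2.1]; ring

theorem growth_const {c : Eps → ℂ} {a : ℝ} (h : NumGrowth c a) (m : ℕ) (K : Set (Rd d)) :
    Growth (fun ε _ => c ε) m K a := by
  obtain ⟨C, hC0, hC⟩ := h.exists_pos
  refine ⟨C, hC.mono fun ε h k _ x _ => ?_⟩
  rcases Nat.eq_zero_or_pos k with rfl | hk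
  · simpa using h
  · rw [iteratedFDeriv_const_of_ne hk.ne']
    simpa using mul_nonneg hC0 (rpow_pos ε a).le

variable (d)

/-- `ℰ_M(ℝ^d)`: the algebra of moderate nets of smooth complex-valued functions. -/
def Moderate : Subalgebra ℂ (Eps → Rd d → ℂ) where
  carrier := {f | (∀ ε, ContDiff ℝ ∞ (f ε)) ∧
    ∀ (m : ℕ) (K : Set (Rd d)), IsCompact K → ∃ a : ℝ, Growth f m K a}
  mul_mem' := by
    rintro f g ⟨hfs, hf⟩ ⟨hgs, hg⟩
    refine ⟨fun ε => (hfs ε).mul (hgs ε), fun m K hK => ?_⟩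
    obtain ⟨a, ha⟩ := hf m K hK
    obtain ⟨b, hb⟩ := hg m K hK
    exact ⟨a + b, ha.mul hfs hgs hb⟩
  add_mem' := by
    rintro f g ⟨hfs, hf⟩ ⟨hgs, hg⟩
    refine ⟨fun ε => (hfs ε).add (hgs ε), fun m K hK => ?_⟩
    obtain ⟨a, ha⟩ := hf m K hK
    obtain ⟨b, hb⟩ := hg m K hK
    exact ⟨min a b, (ha.mono (min_le_left _ _)).add hfs hgs (hb.mono (min_le_right _ _))⟩
  algebraMap_mem' z := ⟨fun ε => contDiff_const, fun m K _ =>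
    ⟨0, growth_const (numGrowth_const z) m K⟩⟩

/-- `𝒩(ℝ^d)`: the ideal of negligible nets. -/
def Negligible : Ideal (Moderate d) where
  carrier := {f | ∀ (m : ℕ) (K : Set (Rd d)), IsCompact K →
    ∀ b : ℝ, Growth (f : Eps → Rd d → ℂ) m K b}
  add_mem' := fun {f g} hf hg m K hK b => (hf m K hK b).add f.2.1 g.2.1 (hg m K hK b)
  zero_mem' := fun m K _ b => by
    have h : NumGrowth (fun _ => (0 : ℂ)) b := ⟨0, Eventually.of_forall fun ε => by simp⟩
    exact growth_const h m K
  smul_mem' := by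
    rintro f g hg m K hK b
    obtain ⟨a, ha⟩ := f.2.2 m K hK
    have := ha.mul f.2.1 g.2.1 (hg m K hK (b - a))
    rwa [add_sub_cancel] at this

/-- `𝒢(ℝ^d) = ℰ_M(ℝ^d) / 𝒩(ℝ^d)`: the Colombeau algebra of generalized functions. -/
abbrev GenFun : Type := Moderate d ⧸ Negligible d

variable {d}

/-- The class `[(f_ε)_ε]` of a moderate net. -/
abbrev GenFun.mk (f : Moderate d) : GenFun d := Ideal.Quotient.mk (Negligible d) f

/-! ### Constants -/

variable (d)

/-- A moderate net of complex numbers seen as a net of constant functions. -/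
def constNet : ModerateNum ℂ →+* Moderate d where
  toFun c := ⟨fun ε _ => (c : Eps → ℂ) ε, fun _ => contDiff_const, fun m K _ => by
    obtain ⟨a, ha⟩ := c.2
    exact ⟨a, growth_const ha m K⟩⟩
  map_one' := rfl
  map_mul' _ _ := rfl
  map_zero' := rfl
  map_add' _ _ := rfl

/-- The canonical map from generalized complex numbers to generalized functions. -/
def constFun : GenNum ℂ →+* GenFun d :=
  Ideal.quotientMap (Negligible d) (constNet d) fun _ hc m K _ b => growth_const (hc b) m K

variable {d}

/-- A generalized function is a constant if it is the class of a net of constant functions. -/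
def IsConst (u : GenFun d) : Prop := ∃ c : GenNum ℂ, u = constFun d c

/-! ### The Laplacian on generalized functions -/

theorem Growth.dirDeriv {f : Eps → Rd d → ℂ} (hfs : ∀ ε, ContDiff ℝ ∞ (f ε)) {m : ℕ}
    {K : Set (Rd d)} {a : ℝ} (hf : Growth f (m + 1) K a) (v : Rd d) :
    Growth (fun ε x => fderiv ℝ (f ε) x v) m K a := by
  obtain ⟨C, hC⟩ := hf
  refine ⟨‖v‖ * C, hC.mono fun ε h k hk x hx => ?_⟩
  have hs : ContDiff ℝ ∞ (fderiv ℝ (f ε)) := (hfs ε).fderiv_right (by simp)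
  have hkk : ((k : ℕ∞) : WithTop ℕ∞) ≤ ∞ := by exact_mod_cast le_top
  calc ‖iteratedFDeriv ℝ k (fun x => fderiv ℝ (f ε) x v) x‖
      ≤ ‖v‖ * ‖iteratedFDeriv ℝ k (fderiv ℝ (f ε)) x‖ :=
        norm_iteratedFDeriv_clm_apply_const hs.contDiffAt hkk
    _ = ‖v‖ * ‖iteratedFDeriv ℝ (k + 1) (f ε) x‖ := by rw [norm_iteratedFDeriv_fderiv]
    _ ≤ ‖v‖ * (C * (ε : ℝ) ^ a) := by
        have := h (k + 1) (by omega) x hx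
        gcongr
    _ = ‖v‖ * C * (ε : ℝ) ^ a := by ring

theorem contDiff_dirDeriv {f : Rd d → ℂ} (hf : ContDiff ℝ ∞ f) (v : Rd d) :
    ContDiff ℝ ∞ (fun x => fderiv ℝ f x v) :=
  (hf.fderiv_right (by simp)).clm_apply contDiff_const

theorem laplacian_eq_sum {f : Rd d → ℂ} (hf : ContDiff ℝ ∞ f) :
    laplacian f = ∑ i : Fin d, fun x =>
      fderiv ℝ (fun y => fderiv ℝ f y (EuclideanSpace.basisFun (Fin d) ℝ i)) x
        (EuclideanSpace.basisFun (Fin d) ℝ i) := by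
  rw [InnerProductSpace.laplacian_eq_iteratedFDeriv_orthonormalBasis f
    (EuclideanSpace.basisFun (Fin d) ℝ)]
  funext x
  rw [Finset.sum_apply]
  refine Finset.sum_congr rfl fun i _ => ?_
  have hs : ContDiff ℝ ∞ (fderiv ℝ f) := hf.fderiv_right (by simp)
  have hd : DifferentiableAt ℝ (fderiv ℝ f) x := hs.contDiffAt.differentiableAt (by simp)
  rw [iteratedFDeriv_two_apply, fderiv_clm_apply hd (differentiableAt_const _)]
  simp

theorem contDiff_laplacian {f : Rd d → ℂ} (hf : ContDiff ℝ ∞ f) : ContDiff ℝ ∞ (laplacian f) := by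
  rw [laplacian_eq_sum hf]
  have h := ContDiff.sum (𝕜 := ℝ) (n := ∞) (s := Finset.univ) (f := fun (i : Fin d) (x : Rd d) =>
      fderiv ℝ (fun y => fderiv ℝ f y (EuclideanSpace.basisFun (Fin d) ℝ i)) x
        (EuclideanSpace.basisFun (Fin d) ℝ i))
    (fun i _ => contDiff_dirDeriv (contDiff_dirDeriv hf _) _)
  convert h using 1
  funext x
  rw [Finset.sum_apply]

theorem Growth.lap {f : Eps → Rd d → ℂ} (hfs : ∀ ε, ContDiff ℝ ∞ (f ε)) {m : ℕ}
    {K : Set (Rd d)} {a : ℝ} (hf : Growth f (m + 2) K a) :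
    Growth (fun ε => laplacian (f ε)) m K a := by
  have key : ∀ s : Finset (Fin d), (∀ ε, ContDiff ℝ ∞ ((∑ i ∈ s, fun (ε : Eps) (x : Rd d) =>
      fderiv ℝ (fun y => fderiv ℝ (f ε) y (EuclideanSpace.basisFun (Fin d) ℝ i)) x
        (EuclideanSpace.basisFun (Fin d) ℝ i)) ε)) ∧
      Growth (∑ i ∈ s, fun (ε : Eps) (x : Rd d) =>
      fderiv ℝ (fun y => fderiv ℝ (f ε) y (EuclideanSpace.basisFun (Fin d) ℝ i)) x
        (EuclideanSpace.basisFun (Fin d) ℝ i)) m K a := by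
    classical
    intro s
    induction s using Finset.induction_on with
    | empty =>
      have h : NumGrowth (fun _ => (0 : ℂ)) a :=
        ⟨0, Eventually.of_forall fun ε => by simp⟩
      exact ⟨fun ε => contDiff_const, growth_const h m K⟩
    | insert i s hi ih =>
      rw [Finset.sum_insert hi]
      have hs1 := fun ε => contDiff_dirDeriv (hfs ε) (EuclideanSpace.basisFun (Fin d) ℝ i)
      have hs2 := fun ε => contDiff_dirDeriv (hs1 ε) (EuclideanSpace.basisFun (Fin d) ℝ i)
      exact ⟨fun ε => (hs2 ε).add (ih.1 ε),
        Growth.add hs2 ih.1 ((hf.dirDeriv hfs _).dirDeriv hs1 _) ih.2⟩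
  have := (key Finset.univ).2
  convert this using 1
  funext ε
  rw [laplacian_eq_sum (hfs ε), Finset.sum_apply]

/-- The Laplacian of a moderate net, taken for each `ε`. -/
def laplacianNet : Moderate d →+ Moderate d where
  toFun f := ⟨fun ε => laplacian ((f : Eps → Rd d → ℂ) ε), fun ε => contDiff_laplacian (f.2.1 ε),
    fun m K hK => by
      obtain ⟨a, ha⟩ := f.2.2 (m + 2) K hK
      exact ⟨a, ha.lap f.2.1⟩⟩
  map_zero' := by
    apply Subtype.ext
    funext ε
    exact InnerProductSpace.laplacian_const (c := (0 : ℂ))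
  map_add' f g := by
    apply Subtype.ext
    funext ε x
    have h2 : (2 : WithTop ℕ∞) ≤ ∞ := by
      exact WithTop.coe_le_coe.mpr (le_top : (2 : ℕ∞) ≤ ⊤)
    exact ContDiffAt.laplacian_add ((f.2.1 ε).of_le h2).contDiffAt ((g.2.1 ε).of_le h2).contDiffAt

/-- The Laplacian `Δ : 𝒢(ℝ^d) → 𝒢(ℝ^d)`, `Δ [(f_ε)_ε] = [(Δ f_ε)_ε]`. -/
def genLaplacian : GenFun d →+ GenFun d :=
  QuotientAddGroup.map (Negligible d).toAddSubgroup (Negligible d).toAddSubgroup laplacianNet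
    fun f hf m K hK b => (hf (m + 2) K hK b).lap f.2.1

/-- Harmonic generalized functions: `Δ u = 0` in `𝒢(ℝ^d)`. -/
def IsHarmonic (u : GenFun d) : Prop := genLaplacian u = 0

/-! ### H-boundedness -/

/-- A global harmonic representative of `u`: a representative, each of whose members is a harmonic
function on the whole of `ℝ^d`. -/
def IsHarmonicRep (G : Moderate d) (u : GenFun d) : Prop :=
  GenFun.mk G = u ∧ ∀ ε, HarmonicOnNhd ((G : Eps → Rd d → ℂ) ε) Set.univ

/-- The property of a net `(v_ε)_ε` that for all `m, a > 0` and all sufficiently small `ε` one has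
`v_ε(t) + ε^a ≥ 0` for `|t| < 1 / ε^m`. For a complex number `z`, the inequality `z ≥ 0` means
that `z` is real and nonnegative. -/
def HNonnegNet (v : Eps → Rd d → ℂ) : Prop :=
  ∀ m : ℝ, 0 < m → ∀ a : ℝ, 0 < a → ∃ ε₀ : ℝ, 0 < ε₀ ∧ ε₀ ≤ 1 ∧
    ∀ ε : Eps, (ε : ℝ) < ε₀ → ∀ t : Rd d, ‖t‖ < 1 / (ε : ℝ) ^ m →
      (v ε t).im = 0 ∧ 0 ≤ (v ε t).re + (ε : ℝ) ^ a

/-- `u` is H-bounded from below by the generalized real number `c`. -/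
def HBoundedBelowBy (u : GenFun d) (c : GenNum ℝ) : Prop :=
  ∃ (G : Moderate d) (r : ModerateNum ℝ), IsHarmonicRep G u ∧
    Ideal.Quotient.mk (NegligibleNum ℝ) r = c ∧
    HNonnegNet fun ε t => (G : Eps → Rd d → ℂ) ε t - (((r : Eps → ℝ) ε : ℝ) : ℂ)

/-- `u` is H-bounded from above by the generalized real number `c`. -/
def HBoundedAboveBy (u : GenFun d) (c : GenNum ℝ) : Prop :=
  ∃ (G : Moderate d) (r : ModerateNum ℝ), IsHarmonicRep G u ∧
    Ideal.Quotient.mk (NegligibleNum ℝ) r = c ∧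
    HNonnegNet fun ε t => (((r : Eps → ℝ) ε : ℝ) : ℂ) - (G : Eps → Rd d → ℂ) ε t

/-- `u` is H-bounded from below. -/
def HBoundedBelow (u : GenFun d) : Prop := ∃ c : GenNum ℝ, HBoundedBelowBy u c

/-- `u` is H-bounded from above. -/
def HBoundedAbove (u : GenFun d) : Prop := ∃ c : GenNum ℝ, HBoundedAboveBy u c

/-- `u` is H-bounded: H-bounded from above and from below. -/
def HBounded (u : GenFun d) : Prop := HBoundedAbove u ∧ HBoundedBelow u

end Functions

end ColombeauAlg

end

namespace ColombeauAlg

open MeasureTheory Metric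
open scoped ContDiff

/-! ### A weighted mean value property of harmonic functions -/

/-! The argument is a quantitative Liouville theorem. Let `g` be harmonic with `g ≥ 0` on the ball
of radius `4R`. Averaging `g` against the weight `w(y) = (1 - |y|²)₊`, centred at `x` or at `0` with
scale `R`, recovers `g x` and `g 0`. The two weights differ by at most a constant times `|x| / R`
times the weight of scale `4R` at `0`. Since `g ≥ 0` there, `|g x - g 0| ≤ C (|x| / R) g 0`
(`abs_sub_le_of_harmonic_of_nonneg`). Apply this to `G_ε - c_ε + ε` with `4R = ε^(-m)`. On a compact
set the oscillation of `G_ε` is `O(ε^m)` times a value at `0` that grows at most like a fixed power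
of `ε`. As `m` is arbitrary, `G_ε - G_ε(0)` is negligible at order zero
(`exists_norm_sub_le_of_hNonneg`). For a moderate net, order zero suffices: Landau interpolation
bounds each derivative by its two neighbours in order, one negligible and the other moderate
(`mem_negligible_of_order_zero`). Hence `u` is the class of the constants `G_ε(0)`. -/

theorem hasDerivAt_max_zero_sq (u : ℝ) :
    HasDerivAt (fun u : ℝ => max u 0 ^ 2) (2 * max u 0) u := by
  rcases lt_trichotomy u 0 with hu | rfl | hu
  · have h : (fun u : ℝ => max u 0 ^ 2) =ᶠ[𝓝 u] fun _ => 0 := by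
      filter_upwards [eventually_lt_nhds hu] with v hv
      simp [max_eq_right hv.le]
    rw [max_eq_right hu.le, mul_zero]
    exact (hasDerivAt_const u (0 : ℝ)).congr_of_eventuallyEq h
  -- At the kink, a quadratic bound forces the derivative to be zero.
  · have h : (fun u : ℝ => max u 0 ^ 2) =O[𝓝 0] fun u => ‖u - 0‖ ^ 2 := by
      refine Asymptotics.IsBigO.of_bound 1 (Eventually.of_forall fun u => ?_)
      rw [sub_zero, one_mul, norm_pow, norm_pow, norm_norm]
      gcongr
      rw [Real.norm_eq_abs, Real.norm_eq_abs, abs_of_nonneg (le_max_right _ _)]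
      exact max_le (le_abs_self u) (abs_nonneg u)
    have h' := (h.hasFDerivAt one_lt_two).hasDerivAt
    simpa using h'
  · have h : (fun u : ℝ => max u 0 ^ 2) =ᶠ[𝓝 u] fun u => u ^ 2 := by
      filter_upwards [eventually_gt_nhds hu] with v hv
      simp [max_eq_left hv.le]
    rw [max_eq_left hu.le]
    simpa using (hasDerivAt_pow 2 u).congr_of_eventuallyEq h

variable {d : ℕ}

/-- The radial weight `y ↦ (1 - |y|²)₊`. -/
noncomputable def quadBump (y : Rd d) : ℝ := max (1 - ‖y‖ ^ 2) 0

theorem quadBump_nonneg (y : Rd d) : 0 ≤ quadBump y := le_max_right _ _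

theorem continuous_quadBump : Continuous (quadBump (d := d)) := by
  unfold quadBump
  fun_prop

theorem quadBump_eq_zero {y : Rd d} (hy : 1 ≤ ‖y‖) : quadBump y = 0 := by
  refine max_eq_right ?_
  nlinarith

theorem hasCompactSupport_quadBump : HasCompactSupport (quadBump (d := d)) :=
  HasCompactSupport.intro (isCompact_closedBall (0 : Rd d) 1) fun y hy => by
    refine quadBump_eq_zero ?_
    rw [mem_closedBall_zero_iff, not_le] at hy
    exact hy.le

/-- The weight `w` itself has a kink on the unit sphere; its square does not. The formula exhibits
the radial field `w(y) y` as `-1/4` times the gradient of `w²`, which is the reason for choosing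
this weight. -/
theorem hasFDerivAt_quadBump_sq (y : Rd d) :
    HasFDerivAt (fun y : Rd d => quadBump y ^ 2) ((-4 * quadBump y) • innerSL ℝ y) y := by
  have h1 : HasFDerivAt (fun y : Rd d => 1 - ‖y‖ ^ 2) (-(2 • innerSL ℝ y)) y :=
    ((hasStrictFDerivAt_norm_sq y).hasFDerivAt).const_sub 1
  refine ((hasDerivAt_max_zero_sq (1 - ‖y‖ ^ 2)).comp_hasFDerivAt y h1).congr_fderiv ?_
  ext v
  simp [quadBump]
  ring

theorem quadBump_ge_of_norm_le {y : Rd d} (hy : ‖y‖ ≤ 1 / 2) : 3 / 4 ≤ quadBump y := by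
  refine le_trans ?_ (le_max_left _ _)
  nlinarith [norm_nonneg y]

theorem abs_quadBump_sub_le (y z : Rd d) :
    |quadBump y - quadBump z| ≤ ‖y - z‖ * (‖y‖ + ‖z‖) := by
  calc |quadBump y - quadBump z| ≤ |(1 - ‖y‖ ^ 2) - (1 - ‖z‖ ^ 2)| := abs_max_sub_max_le_abs _ _ _
    _ = |‖y‖ - ‖z‖| * (‖y‖ + ‖z‖) := by
        have h : (1 - ‖y‖ ^ 2) - (1 - ‖z‖ ^ 2) = -((‖y‖ - ‖z‖) * (‖y‖ + ‖z‖)) := by ring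
        rw [h, abs_neg, abs_mul, abs_of_nonneg (add_nonneg (norm_nonneg y) (norm_nonneg z))]
    _ ≤ ‖y - z‖ * (‖y‖ + ‖z‖) := by
        gcongr
        exact abs_norm_sub_norm_le y z

theorem integral_quadBump_pos : 0 < ∫ y : Rd d, quadBump y := by
  refine continuous_quadBump.integral_pos_of_hasCompactSupport_nonneg_nonzero
    hasCompactSupport_quadBump quadBump_nonneg (x := 0) ?_
  simp [quadBump]

theorem sum_fderiv_fderiv_eq_zero {f : Rd d → ℝ} (hf : ContDiff ℝ 2 f)
    (hΔ : ∀ x, Laplacian.laplacian f x = 0) (x : Rd d) :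
    ∑ i, fderiv ℝ (fun y => fderiv ℝ f y (EuclideanSpace.basisFun (Fin d) ℝ i)) x
      (EuclideanSpace.basisFun (Fin d) ℝ i) = 0 := by
  rw [← hΔ x, InnerProductSpace.laplacian_eq_iteratedFDeriv_orthonormalBasis f
    (EuclideanSpace.basisFun (Fin d) ℝ)]
  refine Finset.sum_congr rfl fun i _ => ?_
  have hs : ContDiff ℝ 1 (fderiv ℝ f) := hf.fderiv_right (by norm_num)
  have hd : DifferentiableAt ℝ (fderiv ℝ f) x := hs.contDiffAt.differentiableAt (by simp)
  rw [iteratedFDeriv_two_apply, fderiv_clm_apply hd (differentiableAt_const _)]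
  simp

/-- Since `w(y) y = -∇(w²)/4`, integration by parts in each coordinate turns the integral into
`(r/4) ∫ w² Δf(x + r y) dy`. Compact support removes boundary terms. -/
theorem integral_quadBump_mul_fderiv_eq_zero {f : Rd d → ℝ} (hf : ContDiff ℝ 2 f)
    (hΔ : ∀ x, Laplacian.laplacian f x = 0) (x : Rd d) (r : ℝ) :
    ∫ y, quadBump y * fderiv ℝ f (x + r • y) y = 0 := by
  set b := EuclideanSpace.basisFun (Fin d) ℝ
  have hs : ContDiff ℝ 1 (fderiv ℝ f) := hf.fderiv_right (by norm_num)
  have hg : ∀ i, ContDiff ℝ 1 fun y => fderiv ℝ f y (b i) := fun i =>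
    hs.clm_apply contDiff_const
  have hgc : ∀ i, Continuous fun y => fderiv ℝ (fun z => fderiv ℝ f z (b i)) y (b i) :=
    fun i => ((hg i).continuous_fderiv (by simp)).clm_apply continuous_const
  have hgr : ∀ i y, HasFDerivAt (fun y => fderiv ℝ f (x + r • y) (b i))
      (r • fderiv ℝ (fun z => fderiv ℝ f z (b i)) (x + r • y)) y := fun i y => by
    have h1 : HasFDerivAt (fun y : Rd d => x + r • y) (r • ContinuousLinearMap.id ℝ (Rd d)) y :=
      ((hasFDerivAt_id y).const_smul r).const_add x
    have h2 := (((hg i).differentiable (by simp)) (x + r • y)).hasFDerivAt.comp y h1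
    refine h2.congr_fderiv ?_
    ext v
    simp
  have hq : ∀ i y, fderiv ℝ (fun y : Rd d => quadBump y ^ 2) y (b i) = -4 * (quadBump y * y i) := by
    intro i y
    rw [(hasFDerivAt_quadBump_sq y).fderiv]
    simp [b, EuclideanSpace.inner_single_right]
    ring
  have hqc : Continuous fun y : Rd d => quadBump y ^ 2 := continuous_quadBump.pow 2
  have hsupp : HasCompactSupport fun y : Rd d => quadBump y ^ 2 :=
    hasCompactSupport_quadBump.comp_left (g := fun t : ℝ => t ^ 2) (by simp)
  have hgrc : ∀ i, Continuous fun y => fderiv ℝ f (x + r • y) (b i) := fun i =>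
    (hg i).continuous.comp (by fun_prop)
  have hgrc' : ∀ i, Continuous fun y =>
      fderiv ℝ (fun z => fderiv ℝ f z (b i)) (x + r • y) (b i) := fun i =>
    (hgc i).comp (by fun_prop : Continuous fun y : Rd d => x + r • y)
  have hint : ∀ i, Integrable fun y : Rd d => (quadBump y * y i) * fderiv ℝ f (x + r • y) (b i) :=
    fun i => ((continuous_quadBump.mul (by fun_prop)).mul (hgrc i)).integrable_of_hasCompactSupport
      (hasCompactSupport_quadBump.mul_right.mul_right)
  have hint' : ∀ i, Integrable fun y : Rd d =>
      quadBump y ^ 2 * fderiv ℝ (fun z => fderiv ℝ f z (b i)) (x + r • y) (b i) := fun i =>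
    (hqc.mul (hgrc' i)).integrable_of_hasCompactSupport hsupp.mul_right
  have key : ∀ i, ∫ y, (quadBump y * y i) * fderiv ℝ f (x + r • y) (b i) =
      r / 4 * ∫ y, quadBump y ^ 2 * fderiv ℝ (fun z => fderiv ℝ f z (b i)) (x + r • y) (b i) := by
    intro i
    have hfd : ∀ y, fderiv ℝ (fun y => fderiv ℝ f (x + r • y) (b i)) y (b i) =
        r * fderiv ℝ (fun z => fderiv ℝ f z (b i)) (x + r • y) (b i) := fun y => by
      rw [(hgr i y).fderiv]; rfl
    have ibp := integral_mul_fderiv_eq_neg_fderiv_mul_of_integrable (μ := volume) (𝕜 := ℝ)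
      (f := fun y : Rd d => quadBump y ^ 2)
      (g := fun y => fderiv ℝ f (x + r • y) (b i)) (v := b i)
      (by
        simp_rw [hq, mul_assoc (-4 : ℝ)]
        exact (hint i).const_mul _)
      (by
        simp_rw [hfd, mul_left_comm _ r]
        exact (hint' i).const_mul r)
      ((hqc.mul (hgrc i)).integrable_of_hasCompactSupport hsupp.mul_right)
      (fun y _ => (hasFDerivAt_quadBump_sq y).differentiableAt)
      (fun y _ => (hgr i y).differentiableAt)
    simp_rw [hq, hfd, mul_left_comm _ r, mul_assoc (-4 : ℝ), integral_const_mul] at ibp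
    linarith
  calc ∫ y, quadBump y * fderiv ℝ f (x + r • y) y
      = ∫ y, ∑ i, (quadBump y * y i) * fderiv ℝ f (x + r • y) (b i) := by
        congr 1
        funext y
        conv_lhs => rw [← b.sum_repr y]
        rw [map_sum, Finset.mul_sum]
        refine Finset.sum_congr rfl fun i _ => ?_
        rw [b.sum_repr y, map_smul, smul_eq_mul, mul_assoc]
        rfl
    _ = ∑ i, r / 4 *
        ∫ y, quadBump y ^ 2 * fderiv ℝ (fun z => fderiv ℝ f z (b i)) (x + r • y) (b i) := by
        rw [integral_finsetSum _ fun i _ => hint i]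
        exact Finset.sum_congr rfl fun i _ => key i
    _ = 0 := by
        rw [← Finset.mul_sum, ← integral_finsetSum _ fun i _ => hint' i]
        simp_rw [← Finset.mul_sum, b, sum_fderiv_fderiv_eq_zero hf hΔ]
        simp

theorem hasDerivAt_integral_quadBump_mul {f : Rd d → ℝ} (hf : ContDiff ℝ 1 f) (x : Rd d) (r : ℝ) :
    HasDerivAt (fun r => ∫ y, quadBump y * f (x + r • y))
      (∫ y, quadBump y * fderiv ℝ f (x + r • y) y) r := by
  have hf' : Continuous (fderiv ℝ f) := hf.continuous_fderiv (by simp)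
  -- `M` bounds the radial derivative for parameters within `1` of `r` and `|y| ≤ 1`; beyond the
  -- unit ball the weight vanishes, so `w M` dominates everywhere.
  obtain ⟨M, hM⟩ := ((isCompact_closedBall r 1).prod
    (isCompact_closedBall (0 : Rd d) 1)).exists_bound_of_continuousOn
    (f := fun p : ℝ × Rd d => fderiv ℝ f (x + p.1 • p.2) p.2) (by
      refine Continuous.continuousOn (Continuous.clm_apply (hf'.comp ?_) continuous_snd)
      fun_prop)
  refine (hasDerivAt_integral_of_dominated_loc_of_deriv_le (μ := volume)
    (F := fun r y => quadBump y * f (x + r • y))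
    (F' := fun r y => quadBump y * fderiv ℝ f (x + r • y) y)
    (bound := fun y => quadBump y * M) (s := closedBall r 1)
    (closedBall_mem_nhds r one_pos) ?_ ?_ ?_ ?_ ?_ ?_).2
  · refine Eventually.of_forall fun s => Continuous.aestronglyMeasurable ?_
    exact continuous_quadBump.mul (hf.continuous.comp (by fun_prop))
  · refine Continuous.integrable_of_hasCompactSupport ?_ hasCompactSupport_quadBump.mul_right
    exact continuous_quadBump.mul (hf.continuous.comp (by fun_prop))
  · refine Continuous.aestronglyMeasurable ?_
    exact continuous_quadBump.mul ((hf'.comp (by fun_prop)).clm_apply continuous_id)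
  · refine Eventually.of_forall fun y s hs => ?_
    rw [norm_mul, Real.norm_of_nonneg (quadBump_nonneg y)]
    rcases le_total ‖y‖ 1 with hy | hy
    · exact mul_le_mul_of_nonneg_left (hM (s, y) ⟨hs, mem_closedBall_zero_iff.2 hy⟩)
        (quadBump_nonneg y)
    · simp [quadBump_eq_zero hy]
  · exact (continuous_quadBump.integrable_of_hasCompactSupport hasCompactSupport_quadBump).mul_const M
  · refine Eventually.of_forall fun y s _ => ?_
    have h1 : HasDerivAt (fun s : ℝ => x + s • y) y s := by
      simpa using ((hasDerivAt_id s).smul_const y).const_add x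
    exact (((hf.differentiable (by simp)) _).hasFDerivAt.comp_hasDerivAt s h1).const_mul _

/-- The weighted average does not depend on the scale `r`, and at `r = 0` it is immediate. -/
theorem integral_quadBump_mul_eq {f : Rd d → ℝ} (hf : ContDiff ℝ 2 f)
    (hΔ : ∀ x, Laplacian.laplacian f x = 0) (x : Rd d) (r : ℝ) :
    ∫ y, quadBump y * f (x + r • y) = f x * ∫ y : Rd d, quadBump y := by
  have h : ∀ s, HasDerivAt (fun r => ∫ y, quadBump y * f (x + r • y)) 0 s := fun s => by
    rw [← integral_quadBump_mul_fderiv_eq_zero hf hΔ x s]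
    exact hasDerivAt_integral_quadBump_mul (hf.of_le (by norm_num)) x s
  have h0 := is_const_of_deriv_eq_zero (fun s => (h s).differentiableAt) (fun s => (h s).deriv) r 0
  rw [h0]
  simp [mul_comm, integral_const_mul]

/-- The substitution `z = x + R y` moves centre and scale into the weight, so that averages at
different points become integrals of the same `f` and can be compared pointwise. -/
theorem integral_quadBump_scaled_mul_eq {f : Rd d → ℝ} (hf : ContDiff ℝ 2 f)
    (hΔ : ∀ x, Laplacian.laplacian f x = 0) (x : Rd d) {R : ℝ} (hR : 0 < R) :
    ∫ z, quadBump (R⁻¹ • (z - x)) * f z = R ^ d * (f x * ∫ y : Rd d, quadBump y) := by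
  rw [← integral_quadBump_mul_eq hf hΔ x R]
  have h := Measure.integral_comp_inv_smul_of_nonneg (volume : Measure (Rd d))
    (fun y => quadBump y * f (x + R • y)) hR.le
  rw [finrank_euclideanSpace_fin, smul_eq_mul] at h
  rw [← h, ← integral_sub_right_eq_self
    (fun y => quadBump (R⁻¹ • y) * f (x + R • R⁻¹ • y)) x]
  congr 1
  funext z
  rw [smul_inv_smul₀ hR.ne', add_sub_cancel]

/-- A Harnack inequality: the oscillation of a nonnegative harmonic function on a large ball. -/
theorem abs_sub_le_of_harmonic_of_nonneg {f : Rd d → ℝ} (hf : ContDiff ℝ 2 f)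
    (hΔ : ∀ x, Laplacian.laplacian f x = 0) {R : ℝ} (hR : 0 < R)
    (hpos : ∀ z, ‖z‖ < 4 * R → 0 ≤ f z) {x : Rd d} (hx : ‖x‖ ≤ R) :
    |f x - f 0| ≤ 7 * 4 ^ d * (‖x‖ / R) * f 0 := by
  have hI := integral_quadBump_pos (d := d)
  set I := ∫ y : Rd d, quadBump y
  have hint : ∀ (a : Rd d) {S : ℝ}, 0 < S →
      Integrable fun z => quadBump (S⁻¹ • (z - a)) * f z := fun a S hS => by
    refine Continuous.integrable_of_hasCompactSupport
      ((continuous_quadBump.comp (by fun_prop)).mul hf.continuous) ?_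
    refine HasCompactSupport.mul_right ?_
    refine HasCompactSupport.intro (isCompact_closedBall a S) fun z hz => quadBump_eq_zero ?_
    rw [mem_closedBall, not_le, dist_eq_norm] at hz
    rw [norm_smul, norm_inv, Real.norm_of_nonneg hS.le, inv_mul_eq_div, one_le_div hS]
    exact hz.le
  have h4R : 0 < 4 * R := by positivity
  -- For `|z| ≤ 2R` the weights differ by at most `5 |x| / R`, as `|z - x| + |z| ≤ 5R`, while the
  -- large weight is at least `3/4`; `7` works because `5 ≤ 7 · 3/4`. For `|z| ≥ 2R` both small
  -- weights vanish. The factor `4 ^ d` arises later, from the volume scaling of the large weight.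
  have hbound : ∀ z, |quadBump (R⁻¹ • (z - x)) * f z - quadBump (R⁻¹ • (z - 0)) * f z| ≤
      7 * (‖x‖ / R) * (quadBump ((4 * R)⁻¹ • (z - 0)) * f z) := by
    intro z
    have hn : ∀ (w : Rd d) {S : ℝ}, 0 < S → ‖S⁻¹ • w‖ = ‖w‖ / S := fun w S hS => by
      rw [norm_smul, norm_inv, Real.norm_of_nonneg hS.le, inv_mul_eq_div]
    have hzx : ‖z‖ ≤ ‖z - x‖ + ‖x‖ := by simpa using norm_add_le (z - x) x
    have hzx' : ‖z - x‖ ≤ ‖z‖ + ‖x‖ := norm_sub_le z x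
    rcases le_total ‖z‖ (2 * R) with hz | hz
    · have hfz : 0 ≤ f z := hpos z (by linarith)
      rw [← sub_mul, abs_mul, abs_of_nonneg hfz, ← mul_assoc]
      refine mul_le_mul_of_nonneg_right ?_ hfz
      have h1 := abs_quadBump_sub_le (R⁻¹ • (z - x)) (R⁻¹ • (z - 0))
      rw [← smul_sub, hn _ hR, hn _ hR, hn _ hR, sub_zero, sub_sub_cancel_left, norm_neg] at h1
      have h2 : 3 / 4 ≤ quadBump ((4 * R)⁻¹ • (z - 0)) := by
        refine quadBump_ge_of_norm_le ?_
        rw [hn _ h4R, sub_zero, div_le_iff₀ h4R]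
        linarith
      have h3 : ‖z - x‖ / R + ‖z‖ / R ≤ 5 := by
        rw [← add_div, div_le_iff₀ hR]
        linarith
      rw [sub_zero z] at h2 ⊢
      have h4 : 0 ≤ ‖x‖ / R := by positivity
      nlinarith
    · have e1 : quadBump (R⁻¹ • (z - x)) = 0 := quadBump_eq_zero (by
        rw [hn _ hR, one_le_div hR]; linarith)
      have e2 : quadBump (R⁻¹ • (z - 0)) = 0 := quadBump_eq_zero (by
        rw [hn _ hR, one_le_div hR, sub_zero]; linarith)
      rw [e1, e2]
      simp only [zero_mul, sub_self, abs_zero]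
      rcases lt_or_ge ‖z‖ (4 * R) with hz' | hz'
      · have := hpos z hz'
        have := quadBump_nonneg ((4 * R)⁻¹ • (z - 0))
        positivity
      · have e3 : quadBump ((4 * R)⁻¹ • (z - 0)) = 0 := quadBump_eq_zero (by
          rw [hn _ h4R, one_le_div h4R, sub_zero]; exact hz')
        rw [e3, zero_mul, mul_zero]
  have hle := (abs_integral_le_integral_abs (μ := volume)).trans
    (integral_mono (((hint x hR).sub (hint 0 hR)).abs)
      ((hint 0 h4R).const_mul (7 * (‖x‖ / R))) hbound)
  simp only [Pi.sub_apply] at hle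
  rw [integral_sub (hint x hR) (hint 0 hR), integral_const_mul,
    integral_quadBump_scaled_mul_eq hf hΔ x hR, integral_quadBump_scaled_mul_eq hf hΔ 0 hR,
    integral_quadBump_scaled_mul_eq hf hΔ 0 h4R, mul_pow] at hle
  have hRI : 0 < R ^ d * I := by positivity
  have e : R ^ d * (f x * I) - R ^ d * (f 0 * I) = (f x - f 0) * (R ^ d * I) := by ring
  rw [e, abs_mul, abs_of_pos hRI] at hle
  refine le_of_mul_le_mul_right (hle.trans_eq ?_) hRI
  ring

end ColombeauAlg

namespace ColombeauAlg

open Metric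
open scoped ContDiff

/-! ### Negligibility of moderate nets follows from estimates of order zero -/

/-- Along a step of length `h`, the increment of `f` is at most `2A` and differs from the linear
term by at most `B h`; divide by `h`. -/
theorem norm_fderiv_le_of_landau {E F : Type*} [NormedAddCommGroup E] [NormedSpace ℝ E]
    [NormedAddCommGroup F] [NormedSpace ℝ F] {f : E → F} (hf : Differentiable ℝ f) {x : E}
    {h A B : ℝ} (hh : 0 < h) (hA : ∀ y ∈ closedBall x h, ‖f y‖ ≤ A)
    (hB : ∀ y ∈ closedBall x h, ‖fderiv ℝ f y - fderiv ℝ f x‖ ≤ B) :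
    ‖fderiv ℝ f x‖ ≤ 2 * A / h + B := by
  have hxx := mem_closedBall_self (x := x) hh.le
  have hA0 : 0 ≤ A := (norm_nonneg _).trans (hA x hxx)
  have hB0 : 0 ≤ B := (norm_nonneg _).trans (hB x hxx)
  refine ContinuousLinearMap.opNorm_le_of_unit_norm (by positivity) fun v hv => ?_
  have hvn : ‖h • v‖ = h := by rw [norm_smul, hv, mul_one, Real.norm_of_nonneg hh.le]
  have hy : x + h • v ∈ closedBall x h := by
    rw [mem_closedBall_iff_norm, add_sub_cancel_left, hvn]
  have h1 := (convex_closedBall x h).norm_image_sub_le_of_norm_fderiv_le'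
    (fun y _ => hf y) hB hxx hy
  rw [add_sub_cancel_left, hvn, map_smul] at h1
  have h2 : h * ‖fderiv ℝ f x v‖ ≤ 2 * A + B * h := by
    calc h * ‖fderiv ℝ f x v‖ = ‖h • fderiv ℝ f x v‖ := by
          rw [norm_smul, Real.norm_of_nonneg hh.le]
      _ = ‖(f (x + h • v) - f x) - (f (x + h • v) - f x - h • fderiv ℝ f x v)‖ := by
          rw [sub_sub_cancel]
      _ ≤ ‖f (x + h • v) - f x‖ + ‖f (x + h • v) - f x - h • fderiv ℝ f x v‖ := norm_sub_le _ _
      _ ≤ (‖f (x + h • v)‖ + ‖f x‖) + B * h := add_le_add (norm_sub_le _ _) h1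
      _ ≤ 2 * A + B * h := by linarith [hA _ hy, hA x hxx]
  have e : 2 * A / h + B = (2 * A + B * h) / h := by field_simp
  rw [e, le_div_iff₀ hh, mul_comm]
  exact h2

/-- A bound on order `k + 2` controls the oscillation of order `k + 1` over the ball by `B h`, which
feeds the first-order estimate. -/
theorem norm_iteratedFDeriv_succ_le_of_landau {E F : Type*} [NormedAddCommGroup E]
    [NormedSpace ℝ E] [NormedAddCommGroup F] [NormedSpace ℝ F] {f : E → F} (hf : ContDiff ℝ ∞ f)
    {k : ℕ} {x : E} {h A B : ℝ} (hh : 0 < h)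
    (hA : ∀ y ∈ closedBall x h, ‖iteratedFDeriv ℝ k f y‖ ≤ A)
    (hB : ∀ y ∈ closedBall x h, ‖iteratedFDeriv ℝ (k + 2) f y‖ ≤ B) :
    ‖iteratedFDeriv ℝ (k + 1) f x‖ ≤ 2 * A / h + B * h := by
  have hdiff : ∀ n : ℕ, Differentiable ℝ (iteratedFDeriv ℝ n f) := fun n =>
    hf.differentiable_iteratedFDeriv (by exact_mod_cast ENat.natCast_lt_top n)
  have hxx := mem_closedBall_self (x := x) hh.le
  have hB0 : 0 ≤ B := (norm_nonneg _).trans (hB x hxx)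
  rw [← norm_fderiv_iteratedFDeriv]
  refine norm_fderiv_le_of_landau (hdiff k) hh hA fun y hy => ?_
  -- The derivative of the `k`-th derivative is the `(k + 1)`-th up to a linear isometry, so the
  -- mean value inequality applies to the latter.
  rw [fderiv_iteratedFDeriv, Function.comp_apply, Function.comp_apply, ← dist_eq_norm,
    LinearIsometryEquiv.dist_map, dist_eq_norm]
  refine ((convex_closedBall x h).norm_image_sub_le_of_norm_fderiv_le
    (fun z _ => hdiff (k + 1) z) (fun z hz => ?_) hxx hy).trans
    (mul_le_mul_of_nonneg_left (mem_closedBall_iff_norm.1 hy) hB0)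
  rw [norm_fderiv_iteratedFDeriv]
  exact hB z hz

variable {d : ℕ}

theorem exists_norm_iteratedFDeriv_le_of_order_zero (f : Moderate d)
    (hf : ∀ K : Set (Rd d), IsCompact K → ∀ b : ℝ, ∃ C : ℝ, ∀ᶠ ε in epsZero, ∀ x ∈ K,
      ‖(f : Eps → Rd d → ℂ) ε x‖ ≤ C * (ε : ℝ) ^ b) (k : ℕ) :
    ∀ K : Set (Rd d), IsCompact K → ∀ b : ℝ, ∃ C : ℝ, ∀ᶠ ε in epsZero, ∀ x ∈ K,
      ‖iteratedFDeriv ℝ k ((f : Eps → Rd d → ℂ) ε) x‖ ≤ C * (ε : ℝ) ^ b := by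
  induction k with
  | zero => simpa only [norm_iteratedFDeriv_zero] using hf
  | succ k ih =>
    intro K hK b
    obtain ⟨a, ha⟩ := f.2.2 (k + 2) (cthickening 1 K) hK.cthickening
    obtain ⟨B, hB0, hB⟩ := ha.exists_pos
    -- The step length is `h = ε^s`: `s ≥ 0` keeps the ball inside the 1-thickening of `K`, and `s ≥
    -- b - a` makes `ε^a h` at most `ε^b`. The loss from dividing by `h` is paid by using the
    -- induction hypothesis with exponent `b + s`.
    set s := max 0 (b - a)
    obtain ⟨A, hA⟩ := ih (cthickening 1 K) hK.cthickening (b + s)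
    refine ⟨2 * A + B, ?_⟩
    filter_upwards [hA, hB] with ε hA hB x hx
    have hsub : closedBall x ((ε : ℝ) ^ s) ⊆ cthickening 1 K :=
      (closedBall_subset_closedBall (Real.rpow_le_one ε.2.1.le ε.2.2 (le_max_left _ _))).trans
        (closedBall_subset_cthickening hx 1)
    refine (norm_iteratedFDeriv_succ_le_of_landau (f.2.1 ε) (rpow_pos ε s)
      (fun y hy => hA y (hsub hy)) (fun y hy => hB (k + 2) le_rfl y (hsub hy))).trans ?_
    have e1 : 2 * (A * (ε : ℝ) ^ (b + s)) / (ε : ℝ) ^ s = 2 * A * (ε : ℝ) ^ b := by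
      rw [Real.rpow_add ε.2.1]
      field_simp [(rpow_pos ε s).ne']
    have e2 : B * (ε : ℝ) ^ a * (ε : ℝ) ^ s ≤ B * (ε : ℝ) ^ b := by
      rw [mul_assoc, ← Real.rpow_add ε.2.1]
      refine mul_le_mul_of_nonneg_left (rpow_le_of_le ε ?_) hB0
      linarith [le_max_right 0 (b - a)]
    rw [e1, add_mul]
    linarith

theorem mem_negligible_of_order_zero (f : Moderate d)
    (hf : ∀ K : Set (Rd d), IsCompact K → ∀ b : ℝ, ∃ C : ℝ, ∀ᶠ ε in epsZero, ∀ x ∈ K,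
      ‖(f : Eps → Rd d → ℂ) ε x‖ ≤ C * (ε : ℝ) ^ b) : f ∈ Negligible d := by
  intro m K hK b
  choose C hC using fun k => exists_norm_iteratedFDeriv_le_of_order_zero f hf k K hK b
  refine ⟨∑ k ∈ Finset.range (m + 1), |C k|, ?_⟩
  have hall : ∀ᶠ ε in epsZero, ∀ k ∈ Finset.range (m + 1), ∀ x ∈ K,
      ‖iteratedFDeriv ℝ k ((f : Eps → Rd d → ℂ) ε) x‖ ≤ C k * (ε : ℝ) ^ b :=
    (eventually_all_finset _).2 fun k _ => hC k
  filter_upwards [hall] with ε h k hk x hx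
  have hk' : k ∈ Finset.range (m + 1) := Finset.mem_range.2 (Nat.lt_succ_of_le hk)
  refine (h k hk' x hx).trans (mul_le_mul_of_nonneg_right ?_ (rpow_pos ε b).le)
  exact (le_abs_self _).trans
    (Finset.single_le_sum (f := fun k => |C k|) (fun i _ => abs_nonneg _) hk')

end ColombeauAlg

namespace ColombeauAlg

open InnerProductSpace (HarmonicOnNhd)
open scoped ContDiff

/-! ### The Liouville theorem -/

variable {d : ℕ}

theorem eventually_epsZero_lt {δ : ℝ} (hδ : 0 < δ) : ∀ᶠ ε : Eps in epsZero, (ε : ℝ) < δ :=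
  tendsto_comap.eventually (eventually_lt_nhds hδ)

/-- The values of a moderate net of functions at a point form a moderate net of numbers. -/
def evalNet (G : Moderate d) (x : Rd d) : ModerateNum ℂ :=
  ⟨fun ε => (G : Eps → Rd d → ℂ) ε x, by
    obtain ⟨a, C, hC⟩ := G.2.2 0 {x} isCompact_singleton
    refine ⟨a, C, hC.mono fun ε h => ?_⟩
    simpa using h 0 le_rfl x rfl⟩

/-- The Harnack bound is applied to `Re g + c`, harmonic on the whole space; the increment `g x - g
0` is real because both points lie in the ball where `g` is real. -/
theorem norm_sub_le_of_harmonic_of_re_nonneg {g : Rd d → ℂ} (hg : HarmonicOnNhd g Set.univ)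
    (c : ℝ) {R : ℝ} (hR : 0 < R) (hpos : ∀ z, ‖z‖ < 4 * R → (g z).im = 0 ∧ 0 ≤ (g z).re + c)
    {x : Rd d} (hx : ‖x‖ ≤ R) :
    ‖g x - g 0‖ ≤ 7 * 4 ^ d * (‖x‖ / R) * ((g 0).re + c) := by
  have hre : HarmonicOnNhd (fun z => (g z).re + c) Set.univ :=
    (hg.comp_CLM Complex.reCLM).add (InnerProductSpace.harmonicOnNhd_const c)
  have h := abs_sub_le_of_harmonic_of_nonneg (f := fun z => (g z).re + c)
    (contDiff_iff_contDiffAt.2 fun z => (hre z trivial).1)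
    (fun z => (hre z trivial).2.self_of_nhds) hR (fun z hz => (hpos z hz).2) hx
  have him : (g x - g 0).im = 0 := by
    rw [Complex.sub_im, (hpos x (by linarith)).1, (hpos 0 (by simpa using hR)).1, sub_zero]
  have e : g x - g 0 = (((g x - g 0).re : ℝ) : ℂ) := Complex.ext rfl (by simpa using him)
  rw [e, Complex.norm_real, Real.norm_eq_abs, Complex.sub_re]
  simpa using h

theorem exists_norm_sub_le_of_hNonneg (G : Moderate d)
    (hG : ∀ ε, HarmonicOnNhd ((G : Eps → Rd d → ℂ) ε) Set.univ) (r : ModerateNum ℝ)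
    (h : HNonnegNet fun ε t => (G : Eps → Rd d → ℂ) ε t - (((r : Eps → ℝ) ε : ℝ) : ℂ))
    {K : Set (Rd d)} (hK : IsCompact K) (b : ℝ) :
    ∃ C : ℝ, ∀ᶠ ε in epsZero, ∀ x ∈ K,
      ‖(G : Eps → Rd d → ℂ) ε x - (G : Eps → Rd d → ℂ) ε 0‖ ≤ C * (ε : ℝ) ^ b := by
  obtain ⟨ρ, hρ0, hρ⟩ := hK.isBounded.exists_pos_norm_le
  obtain ⟨a₁, h₁⟩ := (evalNet G 0).2
  obtain ⟨a₂, h₂⟩ := r.2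
  -- A common growth exponent for `G_ε(0)` and `c_ε`; the cap at `0` also lets `ε^a` absorb the
  -- slack term `ε^1`.
  set a := min 0 (min a₁ a₂)
  obtain ⟨C₁, hC₁0, hC₁⟩ :=
    (h₁.mono ((min_le_right _ _).trans (min_le_left _ _) : a ≤ a₁)).exists_pos
  obtain ⟨C₂, hC₂0, hC₂⟩ :=
    (h₂.mono ((min_le_right _ _).trans (min_le_right _ _) : a ≤ a₂)).exists_pos
  -- `m ≥ b - a` makes the final exponent `m + a` at least `b`; `m ≥ 1` gives `ε^m ≤ ε`, so that `K`
  -- lies in the ball of radius `ε^(-m)/4` once `ε < 1/(4ρ)`.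
  set m := max 1 (b - a)
  have hm1 : 1 ≤ m := le_max_left _ _
  obtain ⟨ε₀, hε₀, -, hv⟩ := h m (by linarith) 1 one_pos
  refine ⟨7 * 4 ^ d * (4 * ρ) * (C₁ + C₂ + 1), ?_⟩
  filter_upwards [hC₁, hC₂, eventually_epsZero_lt hε₀,
    eventually_epsZero_lt (show 0 < 1 / (4 * ρ) by positivity)] with ε hc₁ hc₂ hε hερ x hx
  set g : Rd d → ℂ := fun t => (G : Eps → Rd d → ℂ) ε t - (((r : Eps → ℝ) ε : ℝ) : ℂ)
  have hg : HarmonicOnNhd g Set.univ :=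
    (hG ε).sub (InnerProductSpace.harmonicOnNhd_const (((r : Eps → ℝ) ε : ℝ) : ℂ))
  have hm0 : 0 < (ε : ℝ) ^ m := rpow_pos ε m
  have hmε : (ε : ℝ) ^ m ≤ ε := by simpa using rpow_le_of_le ε hm1
  have hR : 0 < 1 / (4 * (ε : ℝ) ^ m) := by positivity
  have h4R : 4 * (1 / (4 * (ε : ℝ) ^ m)) = 1 / (ε : ℝ) ^ m := by field_simp
  have hxR : ‖x‖ ≤ 1 / (4 * (ε : ℝ) ^ m) := by
    refine (hρ x hx).trans ?_
    rw [lt_div_iff₀ (by positivity)] at hερ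
    rw [le_div_iff₀ (by positivity)]
    nlinarith
  have key := norm_sub_le_of_harmonic_of_re_nonneg hg ((ε : ℝ) ^ (1 : ℝ)) hR
    (fun z hz => hv ε hε z (by rwa [h4R] at hz)) hxR
  have hdiff : g x - g 0 = (G : Eps → Rd d → ℂ) ε x - (G : Eps → Rd d → ℂ) ε 0 :=
    sub_sub_sub_cancel_right _ _ _
  have hg0 : 0 ≤ (g 0).re + (ε : ℝ) ^ (1 : ℝ) :=
    (hv ε hε 0 (by rw [norm_zero]; positivity)).2
  have hg0' : (g 0).re + (ε : ℝ) ^ (1 : ℝ) ≤ (C₁ + C₂ + 1) * (ε : ℝ) ^ a := by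
    have e1 : (g 0).re ≤ ‖(evalNet G 0 : Eps → ℂ) ε‖ + ‖(r : Eps → ℝ) ε‖ :=
      ((Complex.re_le_norm _).trans (norm_sub_le _ _)).trans_eq (by rw [Complex.norm_real]; rfl)
    have e2 : (ε : ℝ) ^ (1 : ℝ) ≤ (ε : ℝ) ^ a :=
      rpow_le_of_le ε ((min_le_left _ _).trans zero_le_one)
    linarith
  have hxρ : ‖x‖ / (1 / (4 * (ε : ℝ) ^ m)) ≤ 4 * ρ * (ε : ℝ) ^ m := by
    have e : ‖x‖ / (1 / (4 * (ε : ℝ) ^ m)) = 4 * ‖x‖ * (ε : ℝ) ^ m := by field_simp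
    rw [e]
    have := hρ x hx
    gcongr
  rw [← hdiff]
  calc ‖g x - g 0‖
      ≤ 7 * 4 ^ d * (‖x‖ / (1 / (4 * (ε : ℝ) ^ m))) * ((g 0).re + (ε : ℝ) ^ (1 : ℝ)) := key
    _ ≤ 7 * 4 ^ d * (4 * ρ * (ε : ℝ) ^ m) * ((C₁ + C₂ + 1) * (ε : ℝ) ^ a) := by gcongr
    _ = 7 * 4 ^ d * (4 * ρ) * (C₁ + C₂ + 1) * (ε : ℝ) ^ (m + a) := by
        rw [Real.rpow_add ε.2.1]; ring
    _ ≤ 7 * 4 ^ d * (4 * ρ) * (C₁ + C₂ + 1) * (ε : ℝ) ^ b := by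
        refine mul_le_mul_of_nonneg_left (rpow_le_of_le ε ?_) (by positivity)
        linarith [le_max_right 1 (b - a)]

theorem HBoundedBelow.isConst {u : GenFun d} (hu : HBoundedBelow u) : IsConst u := by
  obtain ⟨_, G, r, ⟨rfl, hG⟩, -, h⟩ := hu
  refine ⟨Ideal.Quotient.mk _ (evalNet G 0), ?_⟩
  -- The candidate constant is the net of values at the origin, so equality means that `G_ε -
  -- G_ε(0)` is negligible.
  change GenFun.mk G = GenFun.mk (constNet d (evalNet G 0))
  refine Ideal.Quotient.eq.2 (mem_negligible_of_order_zero _ fun K hK b => ?_)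
  exact exists_norm_sub_le_of_hNonneg G hG r h hK b

end ColombeauAlg

theorem mainTheorem10 (d : ℕ) :
    (∀ u : ColombeauAlg.GenFun d, ColombeauAlg.IsHarmonic u → ColombeauAlg.HBoundedBelow u →
      ColombeauAlg.IsConst u) ∧
    (∀ u : ColombeauAlg.GenFun d, ColombeauAlg.IsHarmonic u → ColombeauAlg.HBounded u →
      ColombeauAlg.IsConst u) :=
  ⟨fun _ _ h => h.isConst, fun _ _ h => h.2.isConst⟩
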